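/- **Theorem 5.3 (Foliated Parametric Transversality Theorem).** Manifolds are real, finite-dimensional, Hausdorff, second countable and without boundary, and $r\in\{1,2,3,\dots\}\cup\{\infty,\omega\}$, where $\omega$ (analytic) is larger than $\infty$. Let $\mathcal P$ and $\mathcal Y$ be $C^r$ manifolds and let $\mathcal Z$ be a ($C^r$, embedded) submanifold of $\mathcal Y$. Let $\{\mathcal X_p\}_{p\in\mathcal P}$ be a family of $C^r$ manifolds, all of the same dimension $\dim\mathcal X$, and put $$\mathcal{XP}=\bigcup_{p\in\mathcal P}\mathcal X_p\times\{p\}.$$ Let $F:\mathcal{XP}\to\mathcal Y$ be a map, and for $p\in\mathcal P$ let $F_p:\mathcal X_p\to\mathcal Y$, $F_p(x)=F(x,p)$. Suppose that 1. $r>\max\{0,\ \dim\mathcal X+\dim\mathcal Z-\dim\mathcal Y\}$; 2. $\mathcal{XP}$ is a $C^r$ manifold of dimension $\dim\mathcal X+\dim\mathcal P$, for which the projection $\pi:\mathcal{XP}\to\mathcal P$, $(x,p)\mapsto p$, and the inclusions $\iota_p:\mathcal X_p\to\mathcal{XP}$, $x\mapsto(x,p)$, are $C^r$ maps; 3. the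 tangent spaces split naturally: for each $(x,p)\in\mathcal{XP}$ there is a linear isomorphism $\Phi: T_x\mathcal X_p\times T_p\mathcal P\to T_{(x,p)}\mathcal{XP}$ such that $\Phi(v,0)=(d\iota_p)_x(v)$ and $d\pi_{(x,p)}(\Phi(v,s))=s$ for all $v\in T_x\mathcal X_p$, $s\in T_p\mathcal P$; 4. $F$ is $C^r$; 5. $F$ is transverse to $\mathcal Z$. Then for almost every $p\in\mathcal P$ the map $F_p:\mathcal X_p\to\mathcal Y$ is transverse to $\mathcal Z$; that is, the set of $p$ for which it is not transverse to $\mathcal Z$ has measure zero in $\mathcal P$ (its image in every chart of $\mathcal P$ is Lebesgue null). Here a $C^r$ map $f:\mathcal M\to\mathcal Y$ is *transverse* to $\mathcal Z$ if $df_a(T_a\mathcal M)+T_{f(a)}\mathcal Z=T_{f(a)}\mathcal Y$ for every $a\in f^{-1}(\mathcal Z)$. -/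

import Mathlib

open scoped Manifold ContDiff

universe u v

/-- The foliated set `⋃ p, X p × {p}` of a family `X` of types: its points are the pairs `(x, p)`
with `x ∈ X p`. It carries no topology by default. -/
@[ext]
structure FoliatedSet {P : Type u} (X : P → Type v) : Type (max u v) where
  /-- the parameter `p` of the point `(x, p)` -/
  param : P
  /-- the component `x` of the point `(x, p)` -/
  point : X param

/-- The inclusion `X p → ⋃ p, X p × {p}`, `x ↦ (x, p)`. -/
def FoliatedSet.incl {P : Type u} (X : P → Type v) (p : P) (x : X p) : FoliatedSet X :=
  ⟨p, x⟩

/-- A map `f : M → N` between manifolds is transverse to the submanifold `Z ⊆ N` (whose own manifold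
structure is the given one on the subtype) if `df_a(T_a M) + T_{f a} Z = T_{f a} N` for every
`a ∈ f ⁻¹(Z)`. The tangent space `T_{f a} Z` is viewed in `T_{f a} N` through the differential of
the inclusion `Z → N`. -/
def TransverseTo {m n k : ℕ}
    {M : Type*} [TopologicalSpace M] [ChartedSpace (EuclideanSpace ℝ (Fin m)) M]
    {N : Type*} [TopologicalSpace N] [ChartedSpace (EuclideanSpace ℝ (Fin n)) N]
    (f : M → N) (Z : Set N) [ChartedSpace (EuclideanSpace ℝ (Fin k)) Z] : Prop :=
  ∀ (a : M) (ha : f a ∈ Z),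
    (mfderiv (𝓡 m) (𝓡 n) f a).range ⊔
      (mfderiv (𝓡 k) (𝓡 n) (Subtype.val : Z → N) ⟨f a, ha⟩).range =
    (⊤ : Submodule ℝ (TangentSpace (𝓡 n) (f a)))

/-- A subset `S` of an `n`-dimensional `C^r` manifold has measure zero if its image under every
chart of the `C^r` structure is Lebesgue null in `ℝⁿ`. -/
def IsNullInManifold {n : ℕ} (r : ℕ∞ω)
    {M : Type*} [TopologicalSpace M] [ChartedSpace (EuclideanSpace ℝ (Fin n)) M]
    (S : Set M) : Prop :=
  ∀ φ ∈ IsManifold.maximalAtlas (𝓡 n) r M, MeasureTheory.volume (φ '' (φ.source ∩ S)) = 0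

/-- The natural splitting `T_(x,p) XP ≅ T_x X_p × T_p P`: there is a linear isomorphism under which
the differential of the inclusion `X_p → XP` is `v ↦ (v, 0)` and the differential of the projection
`XP → P` is `(v, s) ↦ s`. -/
def TangentSpacesSplit {k m n : ℕ}
    {P : Type u} [TopologicalSpace P] [ChartedSpace (EuclideanSpace ℝ (Fin m)) P]
    (X : P → Type v) [∀ p, TopologicalSpace (X p)]
    [∀ p, ChartedSpace (EuclideanSpace ℝ (Fin n)) (X p)]
    [TopologicalSpace (FoliatedSet X)] [ChartedSpace (EuclideanSpace ℝ (Fin k)) (FoliatedSet X)] :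
    Prop :=
  ∀ (p : P) (x : X p),
    ∃ Φ : (TangentSpace (𝓡 n) x × TangentSpace (𝓡 m) p) ≃ₗ[ℝ]
        TangentSpace (𝓡 k) (FoliatedSet.incl X p x),
      (∀ v : TangentSpace (𝓡 n) x,
        Φ (v, 0) = mfderiv (𝓡 n) (𝓡 k) (FoliatedSet.incl X p) x v) ∧
      (∀ (v : TangentSpace (𝓡 n) x) (s : TangentSpace (𝓡 m) p),
        mfderiv (𝓡 k) (𝓡 m) (FoliatedSet.param : FoliatedSet X → P) (FoliatedSet.incl X p x)
          (Φ (v, s)) = s)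

/-! Near a point of `Z`, the submanifold lies in the zero set of a map `g` to a space of dimension
`dY - dZ`, with `dg` surjective and of kernel `TZ` at points of `Z`. Transversality of `F` makes `g
∘ F` a submersion along `F ⁻¹(Z)`, so this preimage is locally covered by a `C^k` map `ψ` from
`ℝ^d`, where `d = dX + dP + dZ - dY`. Sard's theorem applies to `π ∘ ψ` as soon as `k > max 0 (d -
dP)`, which is the assumption on `r`. At a regular value `p` of these maps, every `s ∈ T_p P` lifts
to a vector that `dF` sends into `TZ`; subtracting this lift from an arbitrary vector with the same
projection leaves a vector tangent to the leaf, so `F_p` is transverse.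

Sard's theorem is needed with the sharp differentiability, hence Morse's argument. Where `df ≠ 0`,
one slices by a component of `f` and inducts on the target dimension by Fubini. The set `df = 0` is
cut into countably many pieces (`isCountablyFlat_self`), each parametrized so that `f` varies by
`o(‖v - u‖ ^ k)`; a Hausdorff measure estimate (`volume_image_eq_zero_of_isLittleO_pow`) makes their
images null. -/

open Set Filter Topology MeasureTheory

/-! ### Level sets and preliminaries -/

/-- Near a point where a `C^k` map `f` has surjective derivative, every level set of `f` is covered
by the range of a globally defined `C^k` map with values in that level set. -/
theorem exists_levelSet_param {n d : ℕ} {k : ℕ} (hk : k ≠ 0) {G : Type*} [NormedAddCommGroup G]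
    [NormedSpace ℝ G] [FiniteDimensional ℝ G] {f : EuclideanSpace ℝ (Fin n) → G}
    {a : EuclideanSpace ℝ (Fin n)} (hf : ContDiffAt ℝ k f a)
    (hsurj : Function.Surjective (fderiv ℝ f a)) (hd : d + Module.finrank ℝ G = n)
    {U : Set (EuclideanSpace ℝ (Fin n))} (hU : U ∈ 𝓝 a) :
    ∃ V ∈ 𝓝 a, ∀ x₀ ∈ V, ∃ ψ : EuclideanSpace ℝ (Fin d) → EuclideanSpace ℝ (Fin n),
      ContDiff ℝ k ψ ∧ (∀ x ∈ V, f x = f x₀ → x ∈ range ψ) ∧ ∀ u, ψ u ∈ U ∧ f (ψ u) = f x₀ := by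
  have hk' : (k : ℕ∞ω) ≠ 0 := by exact_mod_cast hk
  set f' := fderiv ℝ f a with hf'
  have hker : Module.finrank ℝ f'.ker = d := by
    have h1 := LinearMap.finrank_range_add_finrank_ker (f' : EuclideanSpace ℝ (Fin n) →ₗ[ℝ] G)
    have h2 : (f' : EuclideanSpace ℝ (Fin n) →ₗ[ℝ] G).range = ⊤ := LinearMap.range_eq_top.2 hsurj
    rw [h2, finrank_top, finrank_euclideanSpace_fin] at h1
    have h3 : Module.finrank ℝ f'.ker
      = Module.finrank ℝ (f' : EuclideanSpace ℝ (Fin n) →ₗ[ℝ] G).ker := rfl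
    omega
  obtain ⟨p, hp⟩ := Submodule.ClosedComplemented.of_finiteDimensional f'.ker
  have hpsurj : p.range = ⊤ := LinearMap.range_eq_top.2 fun y => ⟨y, hp y⟩
  have hcompl : IsCompl f'.ker p.ker := LinearMap.isCompl_of_proj hp
  let e₁ := f'.equivProdOfSurjectiveOfIsCompl p (LinearMap.range_eq_top.2 hsurj) hpsurj hcompl
  let e₂ : f'.ker ≃L[ℝ] EuclideanSpace ℝ (Fin d) :=
    ContinuousLinearEquiv.ofFinrankEq (by rw [hker, finrank_euclideanSpace_fin])
  let e₃ := e₁.trans ((ContinuousLinearEquiv.refl ℝ G).prodCongr e₂)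
  -- Pairing `f` with coordinates on the kernel of its derivative gives a local diffeomorphism that
  -- straightens all nearby level sets at once.
  let P : EuclideanSpace ℝ (Fin n) →L[ℝ] EuclideanSpace ℝ (Fin d) := (e₂ : _ →L[ℝ] _).comp p
  let Φ : EuclideanSpace ℝ (Fin n) → G × EuclideanSpace ℝ (Fin d) := fun x => (f x, P x)
  have hΦ : ContDiffAt ℝ k Φ a := hf.prodMk P.contDiff.contDiffAt
  have hΦ' : HasFDerivAt Φ (e₃ : _ →L[ℝ] _) a :=
    ((hf.differentiableAt hk').hasFDerivAt.prodMk P.hasFDerivAt).congr_fderiv (by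
      ext x <;> rfl)
  let e := hΦ.toOpenPartialHomeomorph Φ hΦ' hk'
  have hae : a ∈ e.source := hΦ.mem_toOpenPartialHomeomorph_source hΦ' hk'
  have hsymm : ContDiffAt ℝ k e.symm (Φ a) := hΦ.to_localInverse hΦ' hk'
  have hev : ∀ᶠ z in 𝓝 (Φ a), ContDiffAt ℝ k e.symm z ∧ z ∈ e.target ∧ e.symm z ∈ U := by
    refine (hsymm.eventually (by simp)).and ((e.open_target.eventually_mem (e.map_source hae)).and ?_)
    refine hsymm.continuousAt.preimage_mem_nhds ?_
    rw [show e.symm (Φ a) = a from e.left_inv hae]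
    exact hU
  obtain ⟨r, hr, hball⟩ := Metric.eventually_nhds_iff_ball.1 hev
  refine ⟨e.source ∩ Φ ⁻¹' Metric.ball (Φ a) r, inter_mem (e.open_source.mem_nhds hae)
    (hΦ.continuousAt.preimage_mem_nhds (Metric.ball_mem_nhds _ hr)), fun x₀ hx₀ => ?_⟩
  have hmem : ∀ u, (f x₀, OpenPartialHomeomorph.univBall (P a) r u) ∈ Metric.ball (Φ a) r := by
    intro u
    have h1 : f x₀ ∈ Metric.ball (f a) r := by
      have := hx₀.2
      rw [mem_preimage, ← ball_prod_same] at this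
      exact this.1
    have h2 : OpenPartialHomeomorph.univBall (P a) r u ∈ Metric.ball (P a) r := by
      rw [← OpenPartialHomeomorph.univBall_target (P a) hr]
      exact (OpenPartialHomeomorph.univBall (P a) r).map_source (by simp)
    rw [← ball_prod_same]
    exact ⟨h1, h2⟩
  -- `univBall` identifies all of `ℝ^d` smoothly with a ball, which makes the parametrization
  -- global.
  refine ⟨fun u => e.symm (f x₀, OpenPartialHomeomorph.univBall (P a) r u), ?_, ?_, ?_⟩
  · rw [contDiff_iff_contDiffAt]
    intro u
    exact (hball _ (hmem u)).1.comp u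
      (contDiffAt_const.prodMk OpenPartialHomeomorph.contDiff_univBall.contDiffAt)
  · intro x hx hfx
    have hPx : P x ∈ (OpenPartialHomeomorph.univBall (P a) r).target := by
      rw [OpenPartialHomeomorph.univBall_target (P a) hr]
      have := hx.2
      rw [mem_preimage, ← ball_prod_same] at this
      exact this.2
    refine ⟨(OpenPartialHomeomorph.univBall (P a) r).symm (P x), ?_⟩
    simp only
    rw [OpenPartialHomeomorph.right_inv _ hPx, ← hfx]
    exact e.left_inv hx.1
  · intro u
    obtain ⟨-, h2, h3⟩ := hball _ (hmem u)
    exact ⟨h3, congrArg Prod.fst (e.right_inv h2)⟩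

/-- The image of a set is null if the set is locally covered by sets with null image. -/
theorem measure_image_eq_zero_of_locally {α β : Type*} [TopologicalSpace α]
    [SecondCountableTopology α] [MeasurableSpace β] {μ : Measure β} {f : α → β} {s : Set α}
    (h : ∀ x ∈ s, ∃ u ∈ 𝓝[s] x, μ (f '' u) = 0) : μ (f '' s) = 0 := by
  choose! u hu hμ using h
  obtain ⟨t, hts, htc, hst⟩ := TopologicalSpace.countable_cover_nhdsWithin hu
  refine measure_mono_null (image_mono hst) ?_
  rw [image_iUnion₂]
  exact (measure_biUnion_null_iff htc).2 fun x hx => hμ x (hts hx)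

/-- If `R` is a right inverse of `L`, then `L' ∘ R` stays invertible for `L'` near `L`. -/
theorem isOpen_setOf_surjective_continuousLinearMap {E F : Type*} [NormedAddCommGroup E]
    [NormedSpace ℝ E] [NormedAddCommGroup F] [NormedSpace ℝ F] [FiniteDimensional ℝ F] :
    IsOpen {L : E →L[ℝ] F | Function.Surjective L} := by
  have := FiniteDimensional.complete ℝ F
  rw [isOpen_iff_mem_nhds]
  intro L hL
  obtain ⟨R, hR⟩ := L.exists_rightInverse_of_surjective (LinearMap.range_eq_top.2 hL)
  have hcont : Continuous fun L' : E →L[ℝ] F => L'.comp R := by fun_prop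
  have hunit : {A : F →L[ℝ] F | IsUnit A} ∈ 𝓝 (L.comp R) :=
    Units.isOpen.mem_nhds (by rw [hR]; exact isUnit_one)
  filter_upwards [hcont.continuousAt.preimage_mem_nhds hunit] with L' hL' y
  obtain ⟨A, hA : (A : F →L[ℝ] F) = L'.comp R⟩ := hL'
  refine ⟨R ((↑A⁻¹ : F →L[ℝ] F) y), ?_⟩
  have h1 : (L'.comp R) ((↑A⁻¹ : F →L[ℝ] F) y) = ((A : F →L[ℝ] F) * ↑A⁻¹) y := by rw [← hA]; rfl
  rw [A.mul_inv] at h1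
  exact h1

/-! ### Null images from high-order flatness -/

/-- A set of points `u` at which `g v - g u = o(‖v - u‖ ^ k)` has null image if `k` times the
dimension of the target is at least the dimension of the source. -/
theorem volume_image_eq_zero_of_isLittleO_pow {d m k : ℕ} (hk : 0 < k) (hm : 0 < m)
    (hkm : d ≤ k * m) {g : EuclideanSpace ℝ (Fin d) → Fin m → ℝ}
    {B : Set (EuclideanSpace ℝ (Fin d))}
    (h : ∀ u ∈ B, (fun v => g v - g u) =o[𝓝 u] fun v => ‖v - u‖ ^ k) : volume (g '' B) = 0 := by
  have hμ : ∀ Q : Set (EuclideanSpace ℝ (Fin d)), Bornology.IsBounded Q →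
      μH[(k * m : ℝ)] Q < ⊤ := by
    intro Q hQ
    have h1 : μH[(d : ℝ)] Q < ⊤ := by
      have := MeasureTheory.isAddHaarMeasure_hausdorffMeasure (E := EuclideanSpace ℝ (Fin d))
      rw [finrank_euclideanSpace_fin] at this
      exact hQ.measure_lt_top
    exact (Measure.hausdorffMeasure_mono (by exact_mod_cast hkm) Q).trans_lt h1
  have hvol : (volume : Measure (Fin m → ℝ)) = μH[(m : ℝ)] := by
    rw [← hausdorffMeasure_pi_real, Fintype.card_fin]
  suffices H : ∀ R : ℕ, volume (g '' (B ∩ Metric.ball 0 R)) = 0 by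
    refine measure_mono_null (t := ⋃ R : ℕ, g '' (B ∩ Metric.ball 0 R)) ?_
      (measure_iUnion_null_iff.2 H)
    rintro _ ⟨x, hx, rfl⟩
    obtain ⟨R, hR⟩ := exists_nat_gt ‖x‖
    exact mem_iUnion.2 ⟨R, x, ⟨hx, by simpa using hR⟩, rfl⟩
  intro R
  set Q : Set (EuclideanSpace ℝ (Fin d)) := Metric.ball 0 R with hQ
  set M := μH[(k * m : ℝ)] Q with hM
  have hMtop : M ≠ ⊤ := (hμ Q Metric.isBounded_ball).ne
  -- On small pieces `g` is Hölder of exponent `k` with constant `ε`, so it maps `k * m`-dimensional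
  -- Hausdorff measure to `m`-dimensional measure with factor `ε ^ m`. Finiteness of `M`, due to `d
  -- ≤ k * m`, lets `ε` tend to `0`.
  have key : ∀ ε : NNReal, 0 < ε → volume (g '' (B ∩ Q)) ≤ (ε : ENNReal) ^ (m : ℝ) * M := by
    intro ε hε
    let S : ℕ → Set (EuclideanSpace ℝ (Fin d)) := fun N =>
      {u ∈ B ∩ Q | ∀ v, dist v u < 1 / ((N : ℝ) + 1) → ‖g v - g u‖ ≤ ε * ‖v - u‖ ^ k}
    have hS : B ∩ Q = ⋃ N, S N := by
      refine Subset.antisymm (fun u hu => ?_) (iUnion_subset fun N => sep_subset _ _)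
      have h1 := (h u hu.1).def (NNReal.coe_pos.2 hε)
      obtain ⟨δ, hδ, h2⟩ := Metric.eventually_nhds_iff.1 h1
      obtain ⟨N, hN⟩ := exists_nat_one_div_lt hδ
      refine mem_iUnion.2 ⟨N, hu, fun v hv => ?_⟩
      have := h2 (hv.trans hN)
      rwa [norm_pow, norm_norm] at this
    have hmono : Monotone S := by
      intro N N' hNN u hu
      refine ⟨hu.1, fun v hv => hu.2 v (hv.trans_le ?_)⟩
      have : (N : ℝ) ≤ N' := by exact_mod_cast hNN
      gcongr
    -- Continuity from below along an increasing union needs no measurability of the images.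
    rw [hS, image_iUnion, Monotone.measure_iUnion (fun i j hij => image_mono (hmono hij))]
    refine iSup_le fun N => ?_
    -- Half the radius, so that two points of one piece are within the scale of `S N`; disjointness
    -- lets the bounds add up to `M`.
    let D : ℕ → Set (EuclideanSpace ℝ (Fin d)) := fun j =>
      Metric.ball (TopologicalSpace.denseSeq _ j) (1 / ((N : ℝ) + 1) / 2)
    have hpos : (0 : ℝ) < 1 / ((N : ℝ) + 1) / 2 := by positivity
    have hDuniv : ⋃ j, disjointed D j = univ := by
      rw [iUnion_disjointed, eq_univ_iff_forall]
      intro x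
      obtain ⟨j, hj⟩ := (TopologicalSpace.denseRange_denseSeq _).exists_dist_lt x hpos
      exact mem_iUnion.2 ⟨j, hj⟩
    have hDmeas : ∀ j, MeasurableSet (disjointed D j) :=
      fun j => MeasurableSet.disjointed (fun i => measurableSet_ball) j
    have hpiece : ∀ j, volume (g '' (S N ∩ disjointed D j)) ≤
        (ε : ENNReal) ^ (m : ℝ) * μH[(k * m : ℝ)] (Q ∩ disjointed D j) := by
      intro j
      have hol : HolderOnWith ε k g (S N ∩ disjointed D j) := by
        intro x hx y hy
        have hxy : dist x y < 1 / ((N : ℝ) + 1) := by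
          have h1 : dist x (TopologicalSpace.denseSeq _ j) < _ := disjointed_subset D j hx.2
          have h2 : dist y (TopologicalSpace.denseSeq _ j) < _ := disjointed_subset D j hy.2
          linarith [dist_triangle_right x y (TopologicalSpace.denseSeq _ j)]
        have h3 := hy.1.2 x hxy
        rw [edist_eq_enorm_sub, edist_eq_enorm_sub]
        rw [enorm_eq_nnnorm, enorm_eq_nnnorm]
        rw [NNReal.coe_natCast, ENNReal.rpow_natCast]
        exact_mod_cast h3
      rw [hvol]
      refine (hol.hausdorffMeasure_image_le (by exact_mod_cast hk) (Nat.cast_nonneg m)).trans ?_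
      gcongr
      · exact le_rfl
      · exact fun x hx => hx.1.2
    calc volume (g '' S N) ≤ volume (⋃ j, g '' (S N ∩ disjointed D j)) := by
          rw [← image_iUnion, ← inter_iUnion, hDuniv, inter_univ]
      _ ≤ ∑' j, volume (g '' (S N ∩ disjointed D j)) := measure_iUnion_le _
      _ ≤ ∑' j, (ε : ENNReal) ^ (m : ℝ) * μH[(k * m : ℝ)] (Q ∩ disjointed D j) :=
          ENNReal.tsum_le_tsum hpiece
      _ = (ε : ENNReal) ^ (m : ℝ) * M := by
          rw [ENNReal.tsum_mul_left, ← measure_iUnion, ← inter_iUnion, hDuniv, inter_univ]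
          · exact fun i j hij => ((disjoint_disjointed D hij).inter_left' _).inter_right' _
          · exact fun j => measurableSet_ball.inter (hDmeas j)
  have hlim : Tendsto (fun ε : NNReal => (ε : ENNReal) ^ (m : ℝ) * M) (𝓝[>] 0) (𝓝 0) := by
    have h1 : Tendsto (fun ε : NNReal => (ε : ENNReal) ^ (m : ℝ)) (𝓝 0) (𝓝 0) := by
      have : Continuous (fun ε : NNReal => (ε : ENNReal) ^ (m : ℝ)) :=
        ENNReal.continuous_rpow_const.comp ENNReal.continuous_coe
      convert this.tendsto 0 using 2
      simp [hm.ne']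
    have h2 := ENNReal.Tendsto.mul_const (b := M) h1 (Or.inr hMtop)
    rw [zero_mul] at h2
    exact h2.mono_left nhdsWithin_le_nhds
  exact le_antisymm (ge_of_tendsto hlim (eventually_nhdsWithin_of_forall key)) zero_le

/-! ### Morse's decomposition -/

/-- `T` is covered by a `C^1` parametrization `ψ` along which every `C^k` map vanishing on `A` is
`o(‖v - u‖ ^ k)` at suitable preimages `u` of the points of `T`. -/
def IsFlatlyParametrized {n : ℕ} (k : ℕ) (A T : Set (EuclideanSpace ℝ (Fin n))) : Prop :=
  ∃ d ≤ n, ∃ ψ : EuclideanSpace ℝ (Fin d) → EuclideanSpace ℝ (Fin n), ContDiff ℝ 1 ψ ∧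
    ∀ x ∈ T, ∃ u, ψ u = x ∧
      ∀ (F : Type) [NormedAddCommGroup F] [NormedSpace ℝ F] (f : EuclideanSpace ℝ (Fin n) → F),
        ContDiff ℝ k f → (∀ a ∈ A, f a = 0) →
          (fun v => f (ψ v)) =o[𝓝 u] fun v => ‖v - u‖ ^ k

/-- `S` is covered by countably many sets that are flatly parametrized relative to `A`. -/
def IsCountablyFlat {n : ℕ} (k : ℕ) (A S : Set (EuclideanSpace ℝ (Fin n))) : Prop :=
  ∃ 𝒯 : Set (Set (EuclideanSpace ℝ (Fin n))), 𝒯.Countable ∧ S ⊆ ⋃₀ 𝒯 ∧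
    ∀ T ∈ 𝒯, IsFlatlyParametrized k A T

theorem IsCountablyFlat.union {n k : ℕ} {A S S' : Set (EuclideanSpace ℝ (Fin n))}
    (h : IsCountablyFlat k A S) (h' : IsCountablyFlat k A S') : IsCountablyFlat k A (S ∪ S') := by
  obtain ⟨𝒯, h1, h2, h3⟩ := h
  obtain ⟨𝒯', h1', h2', h3'⟩ := h'
  refine ⟨𝒯 ∪ 𝒯', h1.union h1', ?_, ?_⟩
  · rw [sUnion_union]
    exact union_subset_union h2 h2'
  · rintro T (hT | hT)
    exacts [h3 T hT, h3' T hT]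

theorem IsCountablyFlat.of_locally {n k : ℕ} {A S : Set (EuclideanSpace ℝ (Fin n))}
    (h : ∀ x ∈ S, ∃ V ∈ 𝓝[S] x, IsCountablyFlat k A V) : IsCountablyFlat k A S := by
  choose! V hV 𝒯 h1 h2 h3 using h
  obtain ⟨t, hts, htc, hst⟩ := TopologicalSpace.countable_cover_nhdsWithin hV
  refine ⟨⋃ x ∈ t, 𝒯 x, htc.biUnion fun x hx => h1 x (hts hx), fun y hy => ?_, fun T hT => ?_⟩
  · obtain ⟨x, hx, hyx⟩ := mem_iUnion₂.1 (hst hy)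
    obtain ⟨T, hT, hyT⟩ := h2 x (hts hx) hyx
    exact ⟨T, mem_iUnion₂.2 ⟨x, hx, hT⟩, hyT⟩
  · obtain ⟨x, hx, hTx⟩ := mem_iUnion₂.1 hT
    exact h3 x (hts hx) T hTx

/-- If the derivative of `f` is `o(‖v - u‖ ^ k)` along a `C^1` map `ψ`, then the increment of
`f ∘ ψ` is `o(‖v - u‖ ^ (k + 1))`. -/
theorem isLittleO_pow_succ_of_fderiv {D E F : Type*} [NormedAddCommGroup D] [NormedSpace ℝ D]
    [NormedAddCommGroup E] [NormedSpace ℝ E] [NormedAddCommGroup F] [NormedSpace ℝ F]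
    {f : E → F} {ψ : D → E} (hf : ContDiff ℝ 1 f) (hψ : ContDiff ℝ 1 ψ) {u : D} {k : ℕ}
    (h : (fun v => fderiv ℝ f (ψ v)) =o[𝓝 u] fun v => ‖v - u‖ ^ k) :
    (fun v => f (ψ v) - f (ψ u)) =o[𝓝 u] fun v => ‖v - u‖ ^ (k + 1) := by
  have hcomp : ∀ v, fderiv ℝ (f ∘ ψ) v = (fderiv ℝ f (ψ v)).comp (fderiv ℝ ψ v) := fun v =>
    fderiv_comp v (hf.differentiable one_ne_zero _) (hψ.differentiable one_ne_zero _)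
  have hbd : (fun v => fderiv ℝ ψ v) =O[𝓝 u] fun _ => (1 : ℝ) :=
    ((hψ.continuous_fderiv one_ne_zero).tendsto u).isBigO_one ℝ
  have hder : (fun v => fderiv ℝ (f ∘ ψ) v) =o[𝓝 u] fun v => ‖v - u‖ ^ k := by
    have h1 : (fun v => fderiv ℝ (f ∘ ψ) v) =O[𝓝 u]
        fun v => ‖fderiv ℝ f (ψ v)‖ * ‖fderiv ℝ ψ v‖ :=
      Asymptotics.IsBigO.of_norm_le fun v => by
        rw [hcomp]; exact ContinuousLinearMap.opNorm_comp_le _ _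
    have h2 := h.norm_left.mul_isBigO hbd.norm_left
    simp only [mul_one] at h2
    exact h1.trans_isLittleO h2
  refine Asymptotics.isLittleO_iff.2 fun c hc => ?_
  obtain ⟨δ, hδ, hb⟩ := Metric.eventually_nhds_iff_ball.1 (hder.def hc)
  refine Metric.eventually_nhds_iff_ball.2 ⟨δ, hδ, fun v hv => ?_⟩
  have hconv := convex_closedBall u ‖v - u‖
  have hle : ∀ w ∈ Metric.closedBall u ‖v - u‖, ‖fderiv ℝ (f ∘ ψ) w‖ ≤ c * ‖v - u‖ ^ k := by
    intro w hw
    rw [mem_closedBall_iff_norm] at hw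
    have hw' : w ∈ Metric.ball u δ :=
      mem_ball_iff_norm.2 (hw.trans_lt (mem_ball_iff_norm.1 hv))
    refine (hb w hw').trans ?_
    rw [norm_pow, norm_norm]
    gcongr
  have hmv := hconv.norm_image_sub_le_of_norm_fderiv_le
    (fun w _ => (hf.comp hψ).differentiable one_ne_zero w) hle
    (Metric.mem_closedBall_self (norm_nonneg _)) (mem_closedBall_iff_norm.2 le_rfl)
  rw [norm_pow, norm_norm, pow_succ, ← mul_assoc]
  exact hmv

/-- Morse's decomposition: every set `A` is covered by countably many flatly parametrized sets. -/
theorem isCountablyFlat_self (k : ℕ) :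
    ∀ (n : ℕ) (A : Set (EuclideanSpace ℝ (Fin n))), IsCountablyFlat k A A := by
  induction k with
  | zero =>
    intro n A
    refine ⟨{A}, countable_singleton A, by simp, ?_⟩
    rintro T rfl
    refine ⟨n, le_rfl, id, contDiff_id, fun x hx => ⟨x, rfl, fun F _ _ f hf h0 => ?_⟩⟩
    simp only [pow_zero, id]
    rw [Asymptotics.isLittleO_one_iff, ← h0 x hx]
    exact hf.continuous.tendsto x
  | succ k ihk =>
    intro n
    induction n using Nat.strong_induction_on with
    | _ n ihn =>
    intro A
    -- On `A'`, derivatives of functions vanishing on `A` vanish too, so induction on `k` gains one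
    -- order. Off `A'`, the set `A` lies locally in a hypersurface, and induction on `n` applies.
    let A' : Set (EuclideanSpace ℝ (Fin n)) := {x ∈ A | ∀ g : EuclideanSpace ℝ (Fin n) → ℝ,
      ContDiff ℝ (k + 1 : ℕ) g → (∀ a ∈ A, g a = 0) → fderiv ℝ g x = 0}
    have hA' : A' ⊆ A := sep_subset _ _
    have hk1 : ((k + 1 : ℕ) : ℕ∞ω) ≠ 0 := by exact_mod_cast k.succ_ne_zero
    have h1k : (1 : ℕ∞ω) ≤ ((k + 1 : ℕ) : ℕ∞ω) := by exact_mod_cast k.succ_pos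
    have hflat : IsCountablyFlat (k + 1) A A' := by
      obtain ⟨𝒯, h1, h2, h3⟩ := ihk n A'
      refine ⟨(fun T => T ∩ A') '' 𝒯, h1.image _, ?_, ?_⟩
      · intro x hx
        obtain ⟨T, hT, hxT⟩ := h2 hx
        -- Intersecting with `A'` keeps the base points in `A`, where `f` vanishes and the increment
        -- of `f ∘ ψ` is its value.
        exact ⟨_, ⟨T, hT, rfl⟩, hxT, hx⟩
      · rintro _ ⟨T, hT, rfl⟩
        obtain ⟨d, hd, ψ, hψ, h⟩ := h3 T hT
        refine ⟨d, hd, ψ, hψ, fun x hx => ?_⟩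
        obtain ⟨u, rfl, hu⟩ := h x hx.1
        refine ⟨u, rfl, fun F _ _ f hf h0 => ?_⟩
        have hder : ∀ a ∈ A', fderiv ℝ f a = 0 := by
          intro a ha
          ext w
          refine SeparatingDual.eq_zero_of_forall_dual_eq_zero (R := ℝ) fun ℓ => ?_
          have := ha.2 (ℓ ∘ f) (ℓ.contDiff.comp hf) fun b hb => by simp [h0 b hb]
          rw [(ℓ.hasFDerivAt.comp a (hf.differentiable hk1 a).hasFDerivAt).fderiv] at this
          exact DFunLike.congr_fun this w
        -- Flatness is applied to a map with values in linear maps; hence the arbitrary target `F`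
        -- in the definition.
        have h4 := hu _ (fderiv ℝ f) (hf.fderiv_right (by norm_cast)) hder
        have h5 := isLittleO_pow_succ_of_fderiv (hf.of_le h1k) hψ h4
        simpa [h0 _ (hA' hx.2)] using h5
    have hreg : IsCountablyFlat (k + 1) A (A \ A') := by
      refine IsCountablyFlat.of_locally fun x hx => ?_
      have hg : ∃ g : EuclideanSpace ℝ (Fin n) → ℝ, ContDiff ℝ (k + 1 : ℕ) g ∧
          (∀ a ∈ A, g a = 0) ∧ fderiv ℝ g x ≠ 0 := by
        by_contra! hcon
        exact hx.2 ⟨hx.1, hcon⟩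
      obtain ⟨g, hg, hg0, hgx⟩ := hg
      have hsurj : Function.Surjective (fderiv ℝ g x) :=
        LinearMap.surjective (f := (fderiv ℝ g x : EuclideanSpace ℝ (Fin n) →ₗ[ℝ] ℝ))
          fun h => hgx (ContinuousLinearMap.coe_injective h)
      obtain _ | d := n
      · exact absurd (Subsingleton.elim _ _) hgx
      obtain ⟨V, hV, hψ⟩ := exists_levelSet_param (d := d) k.succ_ne_zero hg.contDiffAt hsurj
        (by simp) univ_mem
      obtain ⟨ψ, hψ, hcov, -⟩ := hψ x (mem_of_mem_nhds hV)
      refine ⟨V ∩ A, inter_mem (mem_nhdsWithin_of_mem_nhds hV)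
        (mem_of_superset self_mem_nhdsWithin sdiff_subset), ?_⟩
      obtain ⟨𝒯, h1, h2, h3⟩ := ihn d d.lt_succ_self (ψ ⁻¹' A)
      refine ⟨(fun T => ψ '' T) '' 𝒯, h1.image _, ?_, ?_⟩
      · rintro y ⟨hyV, hyA⟩
        obtain ⟨u, rfl⟩ := hcov y hyV (by rw [hg0 y hyA, hg0 x hx.1])
        obtain ⟨T, hT, huT⟩ := h2 hyA
        exact ⟨_, ⟨T, hT, rfl⟩, mem_image_of_mem ψ huT⟩
      · rintro _ ⟨T, hT, rfl⟩
        obtain ⟨d', hd', ψ', hψ', h⟩ := h3 T hT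
        refine ⟨d', hd'.trans d.le_succ, ψ ∘ ψ', (hψ.of_le h1k).comp hψ', ?_⟩
        rintro _ ⟨y, hy, rfl⟩
        obtain ⟨u, rfl, hu⟩ := h y hy
        exact ⟨u, rfl, fun F _ _ f hf h0 => hu F (f ∘ ψ) (hf.comp hψ) fun a ha => h0 _ ha⟩
    have := hflat.union hreg
    rwa [union_sdiff_cancel hA'] at this

/-! ### The Morse–Sard theorem -/

/-- The derivative vanishes on the set being decomposed, so it is flat to order `k` along each
parametrization; integrating makes `f` flat to order `k + 1`. -/
theorem volume_image_fderiv_eq_zero {n m k : ℕ} (hm : 0 < m) (hn : n ≤ (k + 1) * m)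
    {f : EuclideanSpace ℝ (Fin n) → Fin m → ℝ} (hf : ContDiff ℝ (k + 1 : ℕ) f) :
    volume (f '' {x | fderiv ℝ f x = 0}) = 0 := by
  obtain ⟨𝒯, h1, h2, h3⟩ := isCountablyFlat_self k n {x | fderiv ℝ f x = 0}
  refine measure_mono_null (image_mono h2) ?_
  rw [image_sUnion]
  refine (measure_sUnion_null_iff (h1.image _)).2 ?_
  rintro _ ⟨T, hT, rfl⟩
  obtain ⟨d, hd, ψ, hψ, h⟩ := h3 T hT
  choose! u hu hflat using h
  refine measure_mono_null (t := (f ∘ ψ) '' (u '' T)) ?_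
    (volume_image_eq_zero_of_isLittleO_pow k.succ_pos hm (hd.trans hn) ?_)
  · rintro _ ⟨x, hx, rfl⟩
    exact ⟨u x, mem_image_of_mem u hx, by simp [hu x hx]⟩
  · rintro _ ⟨x, hx, rfl⟩
    exact isLittleO_pow_succ_of_fderiv (hf.of_le (by exact_mod_cast k.succ_pos)) hψ
      (hflat x hx _ (fderiv ℝ f) (hf.fderiv_right (by norm_cast)) fun a ha => ha)

/-- **Morse–Sard theorem**: the set of critical values of a `C^k` map from `ℝⁿ` to `ℝᵐ` is null
if `k > max 0 (n - m)`. -/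
theorem volume_image_critical_eq_zero_pi {k : ℕ} (hk : k ≠ 0) (m : ℕ) :
    ∀ (n : ℕ), n < k + m → ∀ f : EuclideanSpace ℝ (Fin n) → Fin m → ℝ, ContDiff ℝ k f →
      volume (f '' {x | ¬ Function.Surjective (fderiv ℝ f x)}) = 0 := by
  have hk' : (k : ℕ∞ω) ≠ 0 := by exact_mod_cast hk
  induction m with
  | zero =>
    intro n _ f _
    convert measure_empty (μ := volume)
    rw [image_eq_empty, eq_empty_iff_forall_notMem]
    exact fun x hx => hx fun y => ⟨0, Subsingleton.elim _ _⟩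
  | succ m ih =>
    intro n hn f hf
    set S := {x | ¬ Function.Surjective (fderiv ℝ f x)} with hS
    have hSclosed : IsClosed S := by
      have := isOpen_setOf_surjective_continuousLinearMap.preimage (hf.continuous_fderiv hk')
      exact isOpen_compl_iff.1 (by rw [hS, ← compl_ofPred, compl_compl]; exact this)
    have hsplit : f '' S ⊆ f '' {x | fderiv ℝ f x = 0} ∪ f '' (S ∩ {x | fderiv ℝ f x ≠ 0}) := by
      rw [← image_union]
      refine image_mono fun x hx => ?_
      by_cases h : fderiv ℝ f x = 0
      exacts [Or.inl h, Or.inr ⟨hx, h⟩]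
    refine measure_mono_null hsplit (measure_union_null ?_ ?_)
    · obtain ⟨k, rfl⟩ := Nat.exists_eq_succ_of_ne_zero hk
      refine volume_image_fderiv_eq_zero m.succ_pos ?_ hf
      rw [Nat.succ_eq_add_one] at hn
      nlinarith
    refine measure_image_eq_zero_of_locally fun x hx => ?_
    obtain ⟨i, hi⟩ : ∃ i, fderiv ℝ (fun y => f y i) x ≠ 0 := by
      by_contra! hcon
      refine hx.2 ?_
      ext w i
      have := DFunLike.congr_fun (hcon i) w
      rwa [fderiv_apply (hf.differentiable hk' x)] at this
    set g : EuclideanSpace ℝ (Fin n) → ℝ := fun y => f y i with hg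
    have hgc : ContDiff ℝ k g := contDiff_pi.1 hf i
    have hsurj : ∀ y, fderiv ℝ g y ≠ 0 → Function.Surjective (fderiv ℝ g y) := fun y hy =>
      LinearMap.surjective (f := (fderiv ℝ g y : EuclideanSpace ℝ (Fin n) →ₗ[ℝ] ℝ))
        fun h => hy (ContinuousLinearMap.coe_injective h)
    have hU : {y | fderiv ℝ g y ≠ 0} ∈ 𝓝 x :=
      (hgc.continuous_fderiv hk').continuousAt.eventually_ne hi
    obtain _ | d := n
    · exact absurd (Subsingleton.elim _ _) hi
    obtain ⟨V, hV, hψ⟩ := exists_levelSet_param (d := d) hk hgc.contDiffAt (hsurj x hi)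
      (by simp) hU
    obtain ⟨r, hr, hrV⟩ := Metric.nhds_basis_closedBall.mem_iff.1 hV
    -- A compact piece has compact, hence measurable, image, as Fubini requires.
    set C := Metric.closedBall x r with hC
    refine ⟨S ∩ C, ?_, ?_⟩
    · exact inter_mem (mem_of_superset self_mem_nhdsWithin inter_subset_left)
        (mem_nhdsWithin_of_mem_nhds (Metric.closedBall_mem_nhds x hr))
    have hK : IsCompact (f '' (S ∩ C)) :=
      ((isCompact_closedBall x r).inter_left hSclosed).image hf.continuous
    let e := MeasurableEquiv.piFinSuccAbove (fun _ : Fin (m + 1) => ℝ) i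
    have he : MeasurePreserving e := volume_preserving_piFinSuccAbove _ i
    have hpre : f '' (S ∩ C) = e ⁻¹' (e.symm ⁻¹' (f '' (S ∩ C))) := by
      rw [← preimage_comp, e.symm_comp_self, preimage_id]
    have hmeas : MeasurableSet (e.symm ⁻¹' (f '' (S ∩ C))) := e.symm.measurable hK.measurableSet
    rw [hpre, he.measure_preimage_equiv, Measure.volume_eq_prod, Measure.measure_prod_null hmeas]
    refine Eventually.of_forall fun s => ?_
    by_cases hs : ∃ x₀ ∈ C, g x₀ = s
    swap
    · refine measure_mono_null (t := ∅) (fun y hy => hs ?_) measure_empty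
      obtain ⟨z, hz, hzy⟩ := hy
      refine ⟨z, hz.2, ?_⟩
      have := congrArg (fun w => (e w).1) hzy
      simpa [e] using this
    obtain ⟨x₀, hx₀, rfl⟩ := hs
    obtain ⟨ψ, hψ, hcov, hψU⟩ := hψ x₀ (hrV hx₀)
    let p : (Fin (m + 1) → ℝ) →L[ℝ] (Fin m → ℝ) :=
      ContinuousLinearMap.pi fun j => ContinuousLinearMap.proj (i.succAbove j)
    refine measure_mono_null ?_ (ih d (by omega) (p ∘ f ∘ ψ) (p.contDiff.comp (hf.comp hψ)))
    rintro y ⟨z, hz, hzy⟩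
    have hez : e (f z) = (g x₀, y) := by rw [hzy]; exact e.apply_symm_apply _
    obtain ⟨u, rfl⟩ := hcov z (hrV hz.2) (congrArg Prod.fst hez)
    refine ⟨u, fun hcon => hz.1 ?_, congrArg Prod.snd hez⟩
    have hdf := hf.differentiable hk' (ψ u)
    have hdψ := hψ.differentiable hk' u
    have hpf : fderiv ℝ (p ∘ f ∘ ψ) u = p.comp ((fderiv ℝ f (ψ u)).comp (fderiv ℝ ψ u)) := by
      exact (p.hasFDerivAt.comp u (hdf.hasFDerivAt.comp u hdψ.hasFDerivAt)).fderiv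
    have hgf : ∀ w, fderiv ℝ g (ψ u) w = fderiv ℝ f (ψ u) w i := by
      intro w; rw [hg, fderiv_apply hdf]; rfl
    have hgψ : ∀ v, fderiv ℝ g (ψ u) (fderiv ℝ ψ u v) = 0 := by
      intro v
      have h1 : g ∘ ψ = fun _ => g x₀ := funext fun u => (hψU u).2
      have h2 := fderiv_comp u (hgc.differentiable hk' (ψ u)) hdψ
      rw [h1, fderiv_const_apply] at h2
      exact (DFunLike.congr_fun h2 v).symm
    -- The vector `w₀` fixes coordinate `i`; a vector tangent to the level set of `g` then corrects
    -- the others without changing it.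
    intro y'
    obtain ⟨w₀, hw₀⟩ := hsurj _ (hψU u).1 (y' i)
    obtain ⟨v, hv⟩ := hcon (p (y' - fderiv ℝ f (ψ u) w₀))
    refine ⟨w₀ + fderiv ℝ ψ u v, ?_⟩
    rw [hpf] at hv
    ext j
    rcases Fin.eq_self_or_eq_succAbove i j with rfl | ⟨j', rfl⟩
    · rw [← hgf, map_add, hgψ, hw₀, add_zero]
    · have := congrFun hv j'
      simp only [p, ContinuousLinearMap.comp_apply, ContinuousLinearMap.pi_apply,
        ContinuousLinearMap.proj_apply, Pi.sub_apply] at this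
      rw [map_add, Pi.add_apply, this]
      ring

theorem volume_image_critical_eq_zero {k n m : ℕ} (hk : k ≠ 0) (hn : n < k + m)
    {f : EuclideanSpace ℝ (Fin n) → EuclideanSpace ℝ (Fin m)} (hf : ContDiff ℝ k f) :
    volume (f '' {x | ¬ Function.Surjective (fderiv ℝ f x)}) = 0 := by
  have hk' : (k : ℕ∞ω) ≠ 0 := by exact_mod_cast hk
  let e := EuclideanSpace.equiv (Fin m) ℝ
  have h := volume_image_critical_eq_zero_pi hk m n hn (e ∘ f) (e.contDiff.comp hf)
  have he : MeasurePreserving e := PiLp.volume_preserving_ofLp (Fin m)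
  refine measure_mono_null ?_ (he.quasiMeasurePreserving.preimage_null h)
  rintro _ ⟨x, hx, rfl⟩
  refine ⟨x, fun hcon => hx ?_, rfl⟩
  rw [e.comp_fderiv] at hcon
  intro y
  obtain ⟨v, hv⟩ := hcon (e y)
  exact ⟨v, e.injective hv⟩

/-! ### Local equations of a submanifold -/

theorem mdifferentiable_of_mem_maximalAtlas {n : ℕ} {r : ℕ∞ω} (hr : r ≠ 0) {M : Type*}
    [TopologicalSpace M] [ChartedSpace (EuclideanSpace ℝ (Fin n)) M]
    {φ : OpenPartialHomeomorph M (EuclideanSpace ℝ (Fin n))}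
    (hφ : φ ∈ IsManifold.maximalAtlas (𝓡 n) r M) : φ.MDifferentiable (𝓡 n) (𝓡 n) :=
  ⟨(contMDiffOn_of_mem_maximalAtlas hφ).mdifferentiableOn hr,
    (contMDiffOn_symm_of_mem_maximalAtlas hφ).mdifferentiableOn hr⟩

/-- An embedded submanifold is locally contained in the zero set of a map whose differential at
the points of the submanifold is surjective with kernel the tangent space of the submanifold. -/
theorem exists_local_defining_map {r : ℕ∞ω} (hr : r ≠ 0) {dY dZ : ℕ} {Y : Type*}
    [TopologicalSpace Y] [ChartedSpace (EuclideanSpace ℝ (Fin dY)) Y]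
    (Z : Set Y) [ChartedSpace (EuclideanSpace ℝ (Fin dZ)) Z]
    (hZ : Manifold.IsSmoothEmbedding (𝓡 dZ) (𝓡 dY) r (Subtype.val : Z → Y)) (z : Z) :
    ∃ (C : Type) (_ : NormedAddCommGroup C) (_ : NormedSpace ℝ C) (_ : FiniteDimensional ℝ C),
      dZ + Module.finrank ℝ C = dY ∧ ∃ g : Y → C, ∃ V : Set Y, IsOpen V ∧ (z : Y) ∈ V ∧
        (∀ y ∈ V, ContMDiffAt (𝓡 dY) 𝓘(ℝ, C) r g y) ∧
        ∀ y ∈ V, ∀ hy : y ∈ Z, g y = 0 ∧ Function.Surjective (mfderiv (𝓡 dY) 𝓘(ℝ, C) g y) ∧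
          ∀ w : TangentSpace (𝓡 dY) y, mfderiv (𝓡 dY) 𝓘(ℝ, C) g y w = 0 ↔
            ∃ v, mfderiv (𝓡 dZ) (𝓡 dY) (Subtype.val : Z → Y) ⟨y, hy⟩ v = w := by
  obtain ⟨C, _, _, h⟩ := hZ.isImmersion.isImmersionAt z
  let e := h.equiv
  have hCfin : FiniteDimensional ℝ (EuclideanSpace ℝ (Fin dZ) × C) :=
    e.symm.toLinearEquiv.finiteDimensional
  have hC : FiniteDimensional ℝ C :=
    Module.Finite.of_surjective (LinearMap.snd ℝ (EuclideanSpace ℝ (Fin dZ)) C)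
      LinearMap.snd_surjective
  have hdim : dZ + Module.finrank ℝ C = dY := by
    have := e.toLinearEquiv.finrank_eq
    rwa [Module.finrank_prod, finrank_euclideanSpace_fin, finrank_euclideanSpace_fin] at this
  -- Embeddedness enters here: inside `O`, every point of `Z` lies in the chart domain where the
  -- immersion has its normal form.
  obtain ⟨O, hO, hOφ⟩ := hZ.isEmbedding.isOpen_iff.1 h.domChart.open_source
  have hχ := mdifferentiable_of_mem_maximalAtlas hr h.codChart_mem_maximalAtlas
  have hφ := mdifferentiable_of_mem_maximalAtlas hr h.domChart_mem_maximalAtlas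
  let q : EuclideanSpace ℝ (Fin dY) →L[ℝ] C :=
    (ContinuousLinearMap.snd ℝ (EuclideanSpace ℝ (Fin dZ)) C).comp (e.symm : _ →L[ℝ] _)
  let j : EuclideanSpace ℝ (Fin dZ) →L[ℝ] EuclideanSpace ℝ (Fin dY) :=
    (e : _ →L[ℝ] _).comp (ContinuousLinearMap.inl ℝ (EuclideanSpace ℝ (Fin dZ)) C)
  have hqj : ∀ x, q (j x) = 0 := fun x => by simp [q, j]
  have hqj' : ∀ x, q x = 0 → ∃ y, j y = x := fun x hx =>
    ⟨(e.symm x).1, by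
      have : ((e.symm x).1, (0 : C)) = e.symm x := Prod.ext rfl hx.symm
      simp [j, this]⟩
  have hqsurj : Function.Surjective q := fun c => ⟨e (0, c), by simp [q]⟩
  have hval : ∀ x ∈ h.domChart.source, h.codChart (x : Y) = j (h.domChart x) := by
    intro x hx
    have hm : h.domChart x ∈ (h.domChart.extend (𝓡 dZ)).target := by
      simpa using h.domChart.map_source hx
    have := h.writtenInCharts hm
    simpa [h.domChart.left_inv hx, j] using this
  refine ⟨C, _, _, hC, hdim, q ∘ h.codChart, O ∩ h.codChart.source,
    hO.inter h.codChart.open_source, ⟨?_, h.mem_codChart_source⟩, ?_, ?_⟩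
  · have := h.mem_domChart_source
    rwa [← hOφ] at this
  · exact fun y hy => q.contDiff.contMDiff.contMDiffAt.comp y
      (contMDiffAt_of_mem_maximalAtlas h.codChart_mem_maximalAtlas hy.2)
  · rintro y ⟨hyO, hyχ⟩ hy
    have hyφ : (⟨y, hy⟩ : Z) ∈ h.domChart.source := by rw [← hOφ]; exact hyO
    have hg : HasMFDerivAt (𝓡 dY) 𝓘(ℝ, C) (q ∘ h.codChart) y
        (q.comp (mfderiv (𝓡 dY) (𝓡 dY) h.codChart y)) :=
      q.hasMFDerivAt.comp y (hχ.mdifferentiableAt hyχ).hasMFDerivAt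
    have hv : MDifferentiableAt (𝓡 dZ) (𝓡 dY) (Subtype.val : Z → Y) ⟨y, hy⟩ :=
      hZ.contMDiff.mdifferentiable hr _
    have hcomp : ∀ v, mfderiv (𝓡 dY) (𝓡 dY) h.codChart y
        (mfderiv (𝓡 dZ) (𝓡 dY) (Subtype.val : Z → Y) ⟨y, hy⟩ v) =
        j (mfderiv (𝓡 dZ) (𝓡 dZ) h.domChart ⟨y, hy⟩ v) := by
      intro v
      have h1 : HasMFDerivAt (𝓡 dZ) (𝓡 dY) (h.codChart ∘ (Subtype.val : Z → Y)) ⟨y, hy⟩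
          ((mfderiv (𝓡 dY) (𝓡 dY) h.codChart y).comp
            (mfderiv (𝓡 dZ) (𝓡 dY) (Subtype.val : Z → Y) ⟨y, hy⟩)) :=
        HasMFDerivAt.comp (⟨y, hy⟩ : Z) (hχ.mdifferentiableAt hyχ).hasMFDerivAt hv.hasMFDerivAt
      have h2 : HasMFDerivAt (𝓡 dZ) (𝓡 dY) (j ∘ h.domChart) ⟨y, hy⟩
          (j.comp (mfderiv (𝓡 dZ) (𝓡 dZ) h.domChart ⟨y, hy⟩)) :=
        j.hasMFDerivAt.comp (⟨y, hy⟩ : Z) (hφ.mdifferentiableAt hyφ).hasMFDerivAt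
      have h3 := h2.congr_of_eventuallyEq (f₁ := h.codChart ∘ (Subtype.val : Z → Y))
        (by filter_upwards [h.domChart.open_source.mem_nhds hyφ] with x hx using hval x hx)
      exact DFunLike.congr_fun (hasMFDerivAt_unique h1 h3) v
    refine ⟨?_, ?_, fun w => ?_⟩
    · simp only [Function.comp_apply]
      rw [hval ⟨y, hy⟩ hyφ, hqj]
    · rw [hg.mfderiv]
      exact hqsurj.comp (hχ.mfderiv_surjective hyχ)
    · rw [hg.mfderiv]
      constructor
      · intro hw
        obtain ⟨a, ha⟩ := hqj' _ hw
        obtain ⟨v, rfl⟩ := hφ.mfderiv_surjective hyφ a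
        refine ⟨v, hχ.mfderiv_injective hyχ ((hcomp v).trans ha)⟩
      · rintro ⟨v, rfl⟩
        exact (congrArg q (hcomp v)).trans (hqj _)

/-! ### Transversality and projection to the parameters -/

/-- If `F : M → Y` is transverse to `Z`, then the critical values of the restriction of
`π : M → P` to the preimage of `Z` form a null set in every chart of `P`. -/
theorem volume_critical_values_restrict_preimage {r : ℕ∞ω} {k N dP dY dZ : ℕ}
    (hk : k ≠ 0) (hkr : (k : ℕ∞ω) ≤ r) (hdim : N + dZ < k + dP + dY)
    {M : Type*} [TopologicalSpace M] [SecondCountableTopology M]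
    [ChartedSpace (EuclideanSpace ℝ (Fin N)) M] [IsManifold (𝓡 N) r M]
    {P : Type*} [TopologicalSpace P] [ChartedSpace (EuclideanSpace ℝ (Fin dP)) P]
    {Y : Type*} [TopologicalSpace Y] [ChartedSpace (EuclideanSpace ℝ (Fin dY)) Y]
    (Z : Set Y) [ChartedSpace (EuclideanSpace ℝ (Fin dZ)) Z]
    (hZ : Manifold.IsSmoothEmbedding (𝓡 dZ) (𝓡 dY) r (Subtype.val : Z → Y))
    {π : M → P} (hπ : ContMDiff (𝓡 N) (𝓡 dP) r π)
    {F : M → Y} (hF : ContMDiff (𝓡 N) (𝓡 dY) r F)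
    (hFZ : TransverseTo (m := N) (n := dY) (k := dZ) F Z)
    {φ : OpenPartialHomeomorph P (EuclideanSpace ℝ (Fin dP))}
    (hφ : φ ∈ IsManifold.maximalAtlas (𝓡 dP) r P) :
    volume ((φ ∘ π) '' {a | π a ∈ φ.source ∧ ∃ ha : F a ∈ Z,
      ¬ ∀ s : TangentSpace (𝓡 dP) (π a), ∃ w : TangentSpace (𝓡 N) a,
        mfderiv (𝓡 N) (𝓡 dP) π a w = s ∧
        ∃ v, mfderiv (𝓡 dZ) (𝓡 dY) (Subtype.val : Z → Y) ⟨F a, ha⟩ v =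
          mfderiv (𝓡 N) (𝓡 dY) F a w}) = 0 := by
  have hk' : (k : ℕ∞ω) ≠ 0 := by exact_mod_cast hk
  have hr : r ≠ 0 := fun h => hk' (le_antisymm (h ▸ hkr) bot_le)
  refine measure_image_eq_zero_of_locally fun a ⟨haφ, haZ, _⟩ => ?_
  obtain ⟨C, _, _, _, hC, g, V, hVo, haV, hg, hgZ⟩ :=
    exists_local_defining_map hr Z hZ ⟨F a, haZ⟩
  set χ := chartAt (EuclideanSpace ℝ (Fin N)) a
  have hχA : χ ∈ IsManifold.maximalAtlas (𝓡 N) r M := IsManifold.chart_mem_maximalAtlas a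
  have hχ := mdifferentiable_of_mem_maximalAtlas hr hχA
  have hφd := mdifferentiable_of_mem_maximalAtlas hr hφ
  have haχ : a ∈ χ.source := mem_chart_source _ a
  have hsymm : ∀ x ∈ χ.target, ContMDiffAt (𝓡 N) (𝓡 N) r χ.symm x := fun x hx =>
    contMDiffAt_symm_of_mem_maximalAtlas hχA hx
  have hgF : ∀ b, F b ∈ V → HasMFDerivAt (𝓡 N) 𝓘(ℝ, C) (g ∘ F) b
      ((mfderiv (𝓡 dY) 𝓘(ℝ, C) g (F b)).comp (mfderiv (𝓡 N) (𝓡 dY) F b)) := fun b hb =>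
    ((hg _ hb).mdifferentiableAt hr).hasMFDerivAt.comp b (hF.mdifferentiable hr b).hasMFDerivAt
  set ξ : EuclideanSpace ℝ (Fin N) → C := (g ∘ F) ∘ χ.symm with hξ
  have hχa : χ.symm (χ a) = a := χ.left_inv haχ
  have hξc : ContDiffAt ℝ k ξ (χ a) := by
    refine ContDiffAt.of_le (contMDiffAt_iff_contDiffAt.1 ?_) hkr
    refine ContMDiffAt.comp (χ a) (I' := 𝓡 N) ?_ (hsymm _ (χ.map_source haχ))
    rw [hχa]
    exact (hg _ haV).comp a (hF a)
  -- By transversality any tangent vector of `Y` is in the image of `dF` modulo `TZ`, and `dg` kills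
  -- `TZ`.
  have hξsurj : ∀ x ∈ χ.target, F (χ.symm x) ∈ V → F (χ.symm x) ∈ Z →
      Function.Surjective (fderiv ℝ ξ x) := by
    intro x hx hxV hxZ
    have h1 : HasMFDerivAt (𝓡 N) 𝓘(ℝ, C) ξ x _ :=
      HasMFDerivAt.comp x (hgF _ hxV) (hχ.mdifferentiableAt_symm hx).hasMFDerivAt
    rw [← mfderiv_eq_fderiv, h1.mfderiv]
    intro c
    obtain ⟨t, rfl⟩ := (hgZ _ hxV hxZ).2.1 c
    have ht : t ∈ (⊤ : Submodule ℝ (TangentSpace (𝓡 dY) (F (χ.symm x)))) := Submodule.mem_top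
    rw [← hFZ _ hxZ] at ht
    obtain ⟨_, ⟨w, rfl⟩, _, ⟨v, rfl⟩, rfl⟩ := Submodule.mem_sup.1 ht
    obtain ⟨w', rfl⟩ := hχ.symm.mfderiv_surjective hx w
    refine ⟨w', ?_⟩
    have h2 := ((hgZ _ hxV hxZ).2.2 _).2 ⟨v, rfl⟩
    exact ((map_add _ _ _).trans (add_eq_left.2 h2)).symm
  have hξs : Function.Surjective (fderiv ℝ ξ (χ a)) :=
    hξsurj _ (χ.map_source haχ) (by rwa [hχa]) (by rwa [hχa])
  obtain ⟨d, hd⟩ : ∃ d, d + Module.finrank ℝ C = N := by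
    have := LinearMap.finrank_le_finrank_of_surjective
      (f := (fderiv ℝ ξ (χ a) : EuclideanSpace ℝ (Fin N) →ₗ[ℝ] C)) hξs
    rw [finrank_euclideanSpace_fin] at this
    exact ⟨N - Module.finrank ℝ C, by omega⟩
  let W : Set M := χ.source ∩ (F ⁻¹' V ∩ π ⁻¹' φ.source)
  have hW : IsOpen W := χ.open_source.inter
    ((hVo.preimage hF.continuous).inter (φ.open_source.preimage hπ.continuous))
  have hU : χ.target ∩ χ.symm ⁻¹' W ∈ 𝓝 (χ a) := by
    refine (χ.isOpen_inter_preimage_symm hW).mem_nhds ⟨χ.map_source haχ, ?_⟩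
    rw [mem_preimage, hχa]
    exact ⟨haχ, haV, haφ⟩
  obtain ⟨V', hV', hψ⟩ := exists_levelSet_param hk hξc hξs hd hU
  obtain ⟨ψ, hψ, hcov, hψU⟩ := hψ _ (mem_of_mem_nhds hV')
  have hψm : ContMDiff (𝓡 d) (𝓡 N) k ψ := hψ.contMDiff
  have hψ' : ContMDiff (𝓡 d) (𝓡 N) k (χ.symm ∘ ψ) := fun u =>
    ((hsymm _ (hψU u).1.1).of_le hkr).comp u (hψm u)
  have hh : ContMDiff (𝓡 d) (𝓡 dP) k (φ ∘ π ∘ χ.symm ∘ ψ) := fun u =>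
    ContMDiffAt.comp u
      ((contMDiffAt_of_mem_maximalAtlas hφ (hψU u).1.2.2.2).of_le hkr)
      (((hπ.of_le hkr) _).comp u (hψ' u))
  have hnull := volume_image_critical_eq_zero hk (by omega : d < k + dP)
    (contMDiff_iff_contDiff.1 hh)
  refine ⟨_, inter_mem self_mem_nhdsWithin (mem_nhdsWithin_of_mem_nhds
    (inter_mem (hW.mem_nhds ⟨haχ, haV, haφ⟩)
      ((χ.continuousAt haχ).preimage_mem_nhds hV'))), measure_mono_null ?_ hnull⟩
  rintro _ ⟨b, ⟨⟨hbφ, hbZ, hb⟩, ⟨hbχ, hbV, -⟩, hbV'⟩, rfl⟩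
  have hξab : ξ (χ b) = ξ (χ a) := by
    simp only [hξ, Function.comp_apply, χ.left_inv hbχ, hχa]
    rw [(hgZ _ hbV hbZ).1, (hgZ _ haV haZ).1]
  obtain ⟨u, hu⟩ := hcov _ hbV' hξab
  have hub : χ.symm (ψ u) = b := by rw [hu, χ.left_inv hbχ]
  subst hub
  refine ⟨u, fun hcon => hb fun s => ?_, rfl⟩
  have hd1 : HasMFDerivAt (𝓡 d) (𝓡 N) (χ.symm ∘ ψ) u (mfderiv (𝓡 d) (𝓡 N) (χ.symm ∘ ψ) u) :=
    (hψ'.mdifferentiable hk' u).hasMFDerivAt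
  have hd2 := (hφd.mdifferentiableAt hbφ).hasMFDerivAt.comp (χ.symm (ψ u))
    (hπ.mdifferentiable hr _).hasMFDerivAt
  have hd3 : HasMFDerivAt (𝓡 d) (𝓡 dP) (φ ∘ π ∘ χ.symm ∘ ψ) u _ :=
    HasMFDerivAt.comp u (f := χ.symm ∘ ψ) hd2 hd1
  rw [← mfderiv_eq_fderiv, hd3.mfderiv] at hcon
  obtain ⟨v, hv⟩ := hcon (mfderiv (𝓡 dP) (𝓡 dP) φ _ s)
  refine ⟨mfderiv (𝓡 d) (𝓡 N) (χ.symm ∘ ψ) u v, hφd.mfderiv_injective hbφ hv, ?_⟩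
  -- Since `g ∘ F` is constant along the parametrization, `dg` kills the image of this vector under
  -- `dF`, which puts it in `TZ`.
  refine ((hgZ _ hbV hbZ).2.2 _).1 ?_
  have hd4 : HasMFDerivAt (𝓡 d) 𝓘(ℝ, C) ((g ∘ F) ∘ χ.symm ∘ ψ) u _ :=
    HasMFDerivAt.comp u (f := χ.symm ∘ ψ) (hgF _ hbV) hd1
  have hconst : (g ∘ F) ∘ χ.symm ∘ ψ = fun _ => ξ (χ a) := funext fun u => (hψU u).2
  rw [hconst] at hd4
  exact DFunLike.congr_fun (hasMFDerivAt_unique hd4 (hasMFDerivAt_const _ _)) v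

theorem theorem5p3 {r : ℕ∞ω} {dX dP dY dZ : ℕ}
    -- the `C^r` manifolds `P` and `Y`
    {P : Type*} [TopologicalSpace P] [T2Space P] [SecondCountableTopology P]
    [ChartedSpace (EuclideanSpace ℝ (Fin dP)) P] [IsManifold (𝓡 dP) r P]
    {Y : Type*} [TopologicalSpace Y] [T2Space Y] [SecondCountableTopology Y]
    [ChartedSpace (EuclideanSpace ℝ (Fin dY)) Y] [IsManifold (𝓡 dY) r Y]
    -- the `C^r` submanifold `Z` of `Y`
    (Z : Set Y) [ChartedSpace (EuclideanSpace ℝ (Fin dZ)) Z] [IsManifold (𝓡 dZ) r Z]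
    (hZ : Manifold.IsSmoothEmbedding (𝓡 dZ) (𝓡 dY) r (Subtype.val : Z → Y))
    -- the family of `C^r` manifolds `X p`, all of dimension `dX`
    (X : P → Type*) [∀ p, TopologicalSpace (X p)] [∀ p, T2Space (X p)]
    [∀ p, SecondCountableTopology (X p)]
    [∀ p, ChartedSpace (EuclideanSpace ℝ (Fin dX)) (X p)] [∀ p, IsManifold (𝓡 dX) r (X p)]
    -- the foliated set is a `C^r` manifold of dimension `dX + dP`
    [TopologicalSpace (FoliatedSet X)] [T2Space (FoliatedSet X)]
    [SecondCountableTopology (FoliatedSet X)]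
    [ChartedSpace (EuclideanSpace ℝ (Fin (dX + dP))) (FoliatedSet X)]
    [IsManifold (𝓡 (dX + dP)) r (FoliatedSet X)]
    -- its projection to `P` and the inclusions of the leaves `X p` are `C^r`
    (hproj : ContMDiff (𝓡 (dX + dP)) (𝓡 dP) r (FoliatedSet.param : FoliatedSet X → P))
    (hincl : ∀ p, ContMDiff (𝓡 dX) (𝓡 (dX + dP)) r (FoliatedSet.incl X p))
    -- its tangent spaces split
    (hsplit : TangentSpacesSplit (k := dX + dP) (m := dP) (n := dX) X)
    (F : FoliatedSet X → Y)
    (hr : ((max 0 ((dX : ℤ) + dZ - dY)).toNat : ℕ∞ω) < r)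
    (hF : ContMDiff (𝓡 (dX + dP)) (𝓡 dY) r F)
    (hFZ : TransverseTo (m := dX + dP) (n := dY) (k := dZ) F Z) :
    IsNullInManifold (n := dP) r
      {p : P | ¬ TransverseTo (m := dX) (n := dY) (k := dZ)
        (fun x : X p => F (FoliatedSet.incl X p x)) Z} := by
  -- The least order that Sard's theorem allows; being finite, it covers `r = ∞` and `r = ω` as
  -- well.
  set k : ℕ := (max 0 ((dX : ℤ) + dZ - dY)).toNat + 1 with hk
  have hkr : (k : ℕ∞ω) ≤ r := by
    simpa [hk] using ENat.add_one_natCast_le_withTop_of_lt hr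
  have hr0 : r ≠ 0 := fun h => by simp [h] at hr
  intro φ hφ
  refine measure_mono_null ?_ (volume_critical_values_restrict_preimage (k := k) (by omega) hkr
    (by omega) Z hZ hproj hF hFZ hφ)
  rintro _ ⟨p, ⟨hpφ, hp⟩, rfl⟩
  simp only [mem_ofPred_eq, TransverseTo, not_forall] at hp
  obtain ⟨x, hx, hnt⟩ := hp
  refine ⟨FoliatedSet.incl X p x, ⟨hpφ, hx, fun hsurj => hnt ?_⟩, rfl⟩
  obtain ⟨Φ, hΦ1, hΦ2⟩ := hsplit p x
  have hcomp : HasMFDerivAt (𝓡 dX) (𝓡 dY) (fun x : X p => F (FoliatedSet.incl X p x)) x _ :=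
    HasMFDerivAt.comp x (hF.mdifferentiable hr0 _).hasMFDerivAt
      ((hincl p).mdifferentiable hr0 x).hasMFDerivAt
  rw [hcomp.mfderiv, eq_top_iff]
  intro t _
  have ht : t ∈ (⊤ : Submodule ℝ (TangentSpace (𝓡 dY) (F (FoliatedSet.incl X p x)))) :=
    Submodule.mem_top
  rw [← hFZ _ hx] at ht
  obtain ⟨_, ⟨w, rfl⟩, _, ⟨v, rfl⟩, rfl⟩ := Submodule.mem_sup.1 ht
  obtain ⟨⟨v₀, s⟩, rfl⟩ := Φ.surjective w
  obtain ⟨w', hw', v', hv'⟩ := hsurj s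
  obtain ⟨⟨v₁, s'⟩, rfl⟩ := Φ.surjective w'
  obtain rfl : s' = s := (hΦ2 v₁ s').symm.trans hw'
  -- Here `w = Φ (v₀, s)` and its correction `Φ (v₁, s)` differ by the leaf vector `v₀ - v₁`; the
  -- part of the correction lying in `TZ` is `v'`.
  refine Submodule.mem_sup.2 ⟨_, ⟨v₀ - v₁, rfl⟩, _, ⟨v + v', rfl⟩, ?_⟩
  have h1 : mfderiv (𝓡 dX) (𝓡 (dX + dP)) (FoliatedSet.incl X p) x (v₀ - v₁) =
      Φ (v₀, s') - Φ (v₁, s') := by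
    rw [← hΦ1, ← map_sub, Prod.mk_sub_mk, sub_self]
  have h2 : mfderiv (𝓡 (dX + dP)) (𝓡 dY) F (FoliatedSet.incl X p x)
      (mfderiv (𝓡 dX) (𝓡 (dX + dP)) (FoliatedSet.incl X p) x (v₀ - v₁)) =
      mfderiv (𝓡 (dX + dP)) (𝓡 dY) F (FoliatedSet.incl X p x) (Φ (v₀, s')) -
        mfderiv (𝓡 (dX + dP)) (𝓡 dY) F (FoliatedSet.incl X p x) (Φ (v₁, s')) := by
    rw [h1, map_sub]
  have h3 := map_add (mfderiv (𝓡 dZ) (𝓡 dY) (Subtype.val : Z → Y) ⟨F (FoliatedSet.incl X p x), hx⟩)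
    v v'
  refine (congrArg₂ (· + ·) h2 (h3.trans (congrArg _ hv'))).trans ?_
  abel
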